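/- Let $p\ge 1$ be an integer, $\ell>0$, and let $\hat\sigma\in(0,1)$, $0<\sigma_l<\sigma_u<1$ satisfy $\sigma_l(1+\hat\sigma)^{p-1}<\sigma_u(1-\hat\sigma)^{p-1}$ and $\hat\sigma+\sigma_u<1$. Let $\mathcal F^p_\ell(\mathbb R^d)$ be the class of convex, $p$ times continuously differentiable functions $\Phi:\mathbb R^d\to\mathbb R$ with $\|\nabla^{(p)}\Phi(x')-\nabla^{(p)}\Phi(x)\|_{\rm op}\le \ell\|x'-x\|$ for all $x,x'$. For $M>0$ put $$\Phi_{v,M}(u)=\sum_{j=0}^p\frac1{j!}\nabla^{(j)}\Phi(v)[u-v]^j+\frac{M\|u-v\|^{p+1}}{(p+1)!}.$$ **Framework I** with input $x_0,v_0\in\mathbb R^d$, $\sigma\in(0,1)$, $\theta>0$. Set $A_0=0$. For $k=0,1,2,\dots$: stop if $\nabla\Phi(x_k)=0$; otherwise choose $\lambda_{k+1}>0$ and $(x_{k+1},w_{k+1},\epsilon_{k+1})\in\mathbb R^d\times\mathbb R^d\times[0,\infty)$ such that $\Phi(y)\ge\Phi(x_{k+1})+\langle y-x_{k+1},w_{k+1}\rangle-\epsilon_{k+1}$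 for all $y\in\mathbb R^d$, $$\|\lambda_{k+1}w_{k+1}+x_{k+1}-\tilde v_k\|^2+2\lambda_{k+1}\epsilon_{k+1}\le\sigma^2\|x_{k+1}-\tilde v_k\|^2,\qquad \lambda_{k+1}\|x_{k+1}-\tilde v_k\|^{p-1}\ge\theta,$$ where $a_{k+1}>0$ solves $a_{k+1}^2=\lambda_{k+1}(A_k+a_{k+1})$ and $\tilde v_k=\frac{A_k}{A_k+a_{k+1}}x_k+\frac{a_{k+1}}{A_k+a_{k+1}}v_k$; then set $A_{k+1}=A_k+a_{k+1}$ and $v_{k+1}=v_k-a_{k+1}w_{k+1}$. **Optimal $p$-th order tensor algorithm I** with input $x_0,v_0\in\mathbb R^d$. Set $A_0=0$. For $k=0,1,2,\dots$: stop if $\nabla\Phi(x_k)=0$; otherwise, with $a_{k+1}$ and $\tilde v_k$ related to $\lambda_{k+1}$ as above, choose $\lambda_{k+1}>0$ and $x_{k+1}\in\mathbb R^d$ such that either (i) $\|\lambda_{k+1}\nabla\Phi_{\tilde v_k,\ell}(x_{k+1})+x_{k+1}-\tilde v_k\|\le\hat\sigma\|x_{k+1}-\tilde v_k\|$ and $\frac{\sigma_l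 p!}{2\ell}\le\lambda_{k+1}\|x_{k+1}-\tilde v_k\|^{p-1}\le\frac{\sigma_u p!}{2\ell}$, or (ii) $x_{k+1}$ is a global minimizer of $\Phi_{\tilde v_k,(p+1)\ell}$, that is, of the Taylor polynomial plus $\ell\|u-\tilde v_k\|^{p+1}/p!$, and $\frac{(p-1)!}{2\ell}\le\lambda_{k+1}\|x_{k+1}-\tilde v_k\|^{p-1}\le\frac{p!}{\ell(p+1)}$; then set $A_{k+1}=A_k+a_{k+1}$ and $v_{k+1}=v_k-a_{k+1}\nabla\Phi(x_{k+1})$. **Theorem.** (a) For every $d$ and every $\Phi\in\mathcal F^p_\ell(\mathbb R^d)$, every finite or infinite execution of the algorithm is, with $w_k=\nabla\Phi(x_k)$ and $\epsilon_k=0$, an execution of Framework I. Its parameters are $\theta=\frac{\sigma_l p!}{2\ell}$, $\sigma=\hat\sigma+\sigma_u$ if option (i) is used in every iteration; $\theta=\frac{(p-1)!}{2\ell}$, $\sigma=\frac12$ if option (ii) is used in every iteration; and in general $\theta=\min\{\frac{\sigma_l p!}{2\ell},\frac{(p-1)!}{2\ell}\}$, $\sigma=\max\{\hat\sigma+\sigma_u,\frac12\}$.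 (b) For every $R$ there is a constant $C>0$, depending only on $p,\ell,\hat\sigma,\sigma_l,\sigma_u,R$, such that for every $d$, every $\Phi\in\mathcal F^p_\ell(\mathbb R^d)$, every global minimizer $x^\star$ of $\Phi$, all $x_0,v_0\in\mathbb R^d$ with $\|v_0-x^\star\|\le R$, every execution of the algorithm, and every $k\ge1$ not larger than the number of iterations performed, $$\Phi(x_k)-\Phi(x^\star)\le C\,k^{-\frac{3p+1}2},\qquad \inf_{1\le i\le k}\|\nabla\Phi(x_i)\|^2\le C\,k^{-3p}.$$ -/

import Mathlib

open scoped Nat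

/-- `ℝ^d` with its Euclidean norm. -/
abbrev RVec (d : ℕ) : Type := EuclideanSpace ℝ (Fin d)

/-- Convex functions on `ℝ^d` with `ℓ`-Lipschitz `p`-th order derivative (with respect to the
operator norm of tensors, which is the norm of `iteratedFDeriv`). -/
structure ConvexLipschitzDeriv {d : ℕ} (p : ℕ) (ℓ : ℝ) (Φ : RVec d → ℝ) : Prop where
  convex : ConvexOn ℝ Set.univ Φ
  contDiff : ContDiff ℝ p Φ
  lipschitz : ∀ x x' : RVec d,
    ‖iteratedFDeriv ℝ p Φ x' - iteratedFDeriv ℝ p Φ x‖ ≤ ℓ * ‖x' - x‖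

/-- The `ε`-subdifferential of `f` at `x`. -/
def epsSubdifferential {d : ℕ} (f : RVec d → ℝ) (ε : ℝ) (x : RVec d) : Set (RVec d) :=
  {w | ∀ y : RVec d, f x + inner ℝ (y - x) w - ε ≤ f y}

/-- The regularized `p`-th order Taylor model
`u ↦ ∑_{j ≤ p} (1/j!) ∇^{(j)}Φ(v)[u - v]^j + M ‖u - v‖^{p+1} / (p+1)!`. -/
noncomputable def tensorModel {d : ℕ} (p : ℕ) (M : ℝ) (Φ : RVec d → ℝ) (v u : RVec d) : ℝ :=
  ∑ j ∈ Finset.range (p + 1), (1 / (j ! : ℝ)) * iteratedFDeriv ℝ j Φ v (fun _ => u - v)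
    + M * ‖u - v‖ ^ (p + 1) / ((p + 1)! : ℝ)

/-- The state `(x_k, v_k, A_k)` carried from one iteration to the next. -/
structure IterState (d : ℕ) where
  x : RVec d
  v : RVec d
  A : ℝ

/-- The extrapolated point `ṽ = A/(A+a) x + a/(A+a) v`. -/
noncomputable def IterState.extrapolate {d : ℕ} (S : IterState d) (a : ℝ) : RVec d :=
  (S.A / (S.A + a)) • S.x + (a / (S.A + a)) • S.v

/-- One pass through the loop of Conceptual Algorithmic Framework I: the test `∇Φ(x_k) ≠ 0`,
the choice of `λ_{k+1} = lam`, `x_{k+1} = S'.x`, `w_{k+1} = w`, `ε_{k+1} = ε`, and the update.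
The number `a = a_{k+1}` is the positive root of `a² = λ (A + a)`. -/
structure FrameworkIStep {d : ℕ} (p : ℕ) (σ θ : ℝ) (Φ : RVec d → ℝ)
    (S : IterState d) (lam a : ℝ) (w : RVec d) (ε : ℝ) (S' : IterState d) : Prop where
  not_stopped : gradient Φ S.x ≠ 0
  lam_pos : 0 < lam
  eps_nonneg : 0 ≤ ε
  a_pos : 0 < a
  a_sq : a ^ 2 = lam * (S.A + a)
  mem_subdiff : w ∈ epsSubdifferential Φ ε S'.x
  rel_error : ‖lam • w + S'.x - S.extrapolate a‖ ^ 2 + 2 * lam * ε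
    ≤ σ ^ 2 * ‖S'.x - S.extrapolate a‖ ^ 2
  large_step : θ ≤ lam * ‖S'.x - S.extrapolate a‖ ^ (p - 1)
  A_update : S'.A = S.A + a
  v_update : S'.v = S.v - a • w

/-- `S` follows Conceptual Algorithmic Framework I, with input `x₀, v₀, σ, θ`, during its first
`N` iterations (`N = ⊤` for an infinite execution). -/
structure IsFrameworkIRun {d : ℕ} (p : ℕ) (σ θ : ℝ) (Φ : RVec d → ℝ) (x₀ v₀ : RVec d) (N : ℕ∞)
    (S : ℕ → IterState d) (lam a : ℕ → ℝ) (w : ℕ → RVec d) (ε : ℕ → ℝ) : Prop where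
  sigma_mem : 0 < σ ∧ σ < 1
  theta_pos : 0 < θ
  init : S 0 = ⟨x₀, v₀, 0⟩
  step : ∀ k : ℕ, (k : ℕ∞) < N →
    FrameworkIStep p σ θ Φ (S k) (lam (k + 1)) (a (k + 1)) (w (k + 1)) (ε (k + 1)) (S (k + 1))

/-- The conditions on the parameters `σ̂, σ_l, σ_u` of the optimal tensor algorithm. -/
structure AdmissibleParams (p : ℕ) (σhat σl σu : ℝ) : Prop where
  hat_pos : 0 < σhat
  hat_lt_one : σhat < 1
  l_pos : 0 < σl
  l_lt_u : σl < σu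
  u_lt_one : σu < 1
  search : σl * (1 + σhat) ^ (p - 1) < σu * (1 - σhat) ^ (p - 1)
  sum_lt_one : σhat + σu < 1

/-- First option: `x` is a `σ̂`-inexact solution of
`min_u Φ_v(u) + ‖u - v‖² / (2λ)`, where `Φ_v` has the regularization `ℓ ‖u - v‖^{p+1} / (p+1)!`,
and `λ` and `x` satisfy the corresponding two-sided bound. -/
structure InexactOption {d : ℕ} (p : ℕ) (ℓ σhat σl σu : ℝ) (Φ : RVec d → ℝ)
    (lam : ℝ) (v x : RVec d) : Prop where
  inexact : ‖lam • gradient (tensorModel p ℓ Φ v) x + x - v‖ ≤ σhat * ‖x - v‖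
  lower : σl * (p ! : ℝ) / (2 * ℓ) ≤ lam * ‖x - v‖ ^ (p - 1)
  upper : lam * ‖x - v‖ ^ (p - 1) ≤ σu * (p ! : ℝ) / (2 * ℓ)

/-- Second option: `x` is an exact minimizer of the Taylor model with the regularization
`ℓ ‖u - v‖^{p+1} / p!`, which is `(p+1) ℓ ‖u - v‖^{p+1} / (p+1)!`, and `λ` and `x` satisfy the
corresponding two-sided bound. -/
structure ExactOption {d : ℕ} (p : ℕ) (ℓ : ℝ) (Φ : RVec d → ℝ)
    (lam : ℝ) (v x : RVec d) : Prop where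
  exact_min : IsMinOn (tensorModel p ((p + 1 : ℝ) * ℓ) Φ v) Set.univ x
  lower : ((p - 1)! : ℝ) / (2 * ℓ) ≤ lam * ‖x - v‖ ^ (p - 1)
  upper : lam * ‖x - v‖ ^ (p - 1) ≤ (p ! : ℝ) / (ℓ * (p + 1))

/-- One pass through the loop of the optimal `p`-th order tensor algorithm I. -/
structure OptimalIStep {d : ℕ} (p : ℕ) (ℓ σhat σl σu : ℝ) (Φ : RVec d → ℝ)
    (S : IterState d) (lam a : ℝ) (S' : IterState d) : Prop where
  not_stopped : gradient Φ S.x ≠ 0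
  lam_pos : 0 < lam
  a_pos : 0 < a
  a_sq : a ^ 2 = lam * (S.A + a)
  option : InexactOption p ℓ σhat σl σu Φ lam (S.extrapolate a) S'.x ∨
    ExactOption p ℓ Φ lam (S.extrapolate a) S'.x
  A_update : S'.A = S.A + a
  v_update : S'.v = S.v - a • gradient Φ S'.x

/-- `S` follows the optimal `p`-th order tensor algorithm I, started at `x₀, v₀`, during its first
`N` iterations (`N = ⊤` for an infinite execution). -/
structure IsOptimalIRun {d : ℕ} (p : ℕ) (ℓ σhat σl σu : ℝ) (Φ : RVec d → ℝ)
    (x₀ v₀ : RVec d) (N : ℕ∞) (S : ℕ → IterState d) (lam a : ℕ → ℝ) : Prop where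
  init : S 0 = ⟨x₀, v₀, 0⟩
  step : ∀ k : ℕ, (k : ℕ∞) < N →
    OptimalIStep p ℓ σhat σl σu Φ (S k) (lam (k + 1)) (a (k + 1)) (S (k + 1))

/-! Part (a) is a perturbation estimate. The gradient of the model at `ṽ` is the Taylor polynomial
of `∇Φ` of order `p - 1` plus the gradient of the regularizer, so it determines `∇Φ(x)` up to an
error `ℓ ‖x - ṽ‖^p / p!`. Multiplied by `λ`, this error is controlled by the two-sided bounds on `λ
‖x - ṽ‖^(p-1)`, which gives the relative error condition with `w = ∇Φ(x)`; convexity gives the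
subgradient inequality with `ε = 0`.

Part (b) holds for Framework I itself, for any function and any `ε`-subgradients. The potential `A
(Φ(x) - Φ(x⋆)) + ‖v - x⋆‖² / 2` decreases (`FrameworkIStep.potential_le`), so `Φ(x_k) - Φ(x⋆) = O(1
/ A_k)` and `∑ A_j r_j² / λ_j` stays bounded, where `r_j = ‖x_j - ṽ_{j-1}‖`. The rest concerns real
sequences only (`LargeSteps`). Since `∑ √λ_j ≤ 2 √A_k` and `λ_j r_j^(p-1) ≥ θ`, Hölder's inequality
yields a discrete differential inequality for `∑ A_j^α`, whence `A_k ≥ c k^((3p+1)/2)`. For the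
gradients, `λ_j ‖w_j‖ ≤ 2 r_j` bounds a power of `‖w_j‖` by `r_j² / λ_j`; weighting by `A_j` and
summing gives the rate `k^(-3p)`. -/

/-! ### Symmetry of higher derivatives and Taylor's inequality -/

/-- The `n`-th derivative of a `C^n` function, evaluated at `h, …, h, y, h, …, h`, does not depend
on the position of `y`. -/
theorem iteratedFDeriv_update_const.{u} {E : Type u} [NormedAddCommGroup E] [NormedSpace ℝ E]
    (n : ℕ) : ∀ {F : Type u} [NormedAddCommGroup F] [NormedSpace ℝ F] {f : E → F},
    ContDiff ℝ n f → ∀ (x h y : E) (i j : Fin n),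
      iteratedFDeriv ℝ n f x (Function.update (fun _ => h) i y) =
        iteratedFDeriv ℝ n f x (Function.update (fun _ => h) j y) := by
  induction n with
  | zero => intro F _ _ f _ x h y i; exact i.elim0
  | succ n ih =>
    intro F _ _ f hf x h y
    have hf' : ContDiff ℝ n (fderiv ℝ f) := hf.fderiv_right le_rfl
    have right : ∀ i j : Fin n,
        iteratedFDeriv ℝ (n + 1) f x (Function.update (fun _ => h) i.castSucc y) =
          iteratedFDeriv ℝ (n + 1) f x (Function.update (fun _ => h) j.castSucc y) := by
      have key : ∀ i : Fin n,
          iteratedFDeriv ℝ (n + 1) f x (Function.update (fun _ => h) i.castSucc y) =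
            iteratedFDeriv ℝ n (fderiv ℝ f) x (Function.update (fun _ => h) i y) h := by
        intro i
        rw [iteratedFDeriv_succ_apply_right, Fin.init_update_castSucc,
          Function.update_of_ne (Fin.castSucc_lt_last i).ne']
        rfl
      intro i j
      rw [key, key, ih hf' x h y i j]
    have left : ∀ i j : Fin n,
        iteratedFDeriv ℝ (n + 1) f x (Function.update (fun _ => h) i.succ y) =
          iteratedFDeriv ℝ (n + 1) f x (Function.update (fun _ => h) j.succ y) := by
      have hd : DifferentiableAt ℝ (iteratedFDeriv ℝ n f) x :=
        (hf.differentiable_iteratedFDeriv (by exact_mod_cast Nat.lt_succ_self n)) x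
      have key : ∀ i : Fin n,
          iteratedFDeriv ℝ (n + 1) f x (Function.update (fun _ => h) i.succ y) =
            fderiv ℝ (fun z => iteratedFDeriv ℝ n f z (Function.update (fun _ => h) i y)) x h := by
        intro i
        rw [iteratedFDeriv_succ_apply_left, Fin.tail_update_succ,
          Function.update_of_ne (Fin.succ_ne_zero i).symm,
          fderiv_continuousMultilinear_apply_const_apply hd]
        rfl
      intro i j
      rw [key, key]
      congr 2
      ext z
      exact ih (hf.of_le (by exact_mod_cast Nat.le_succ n)) z h y i j
    -- `right` relates all slots but the last, `left` all slots but the first. These ranges meet in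
    -- slot 1 from order 3 on; order 2 is the one case that needs symmetry of the second derivative.
    rcases n with _ | _ | n
    · intro i j; rw [Fin.fin_one_eq_zero i, Fin.fin_one_eq_zero j]
    · have hs : IsSymmSndFDerivAt ℝ f x :=
        hf.contDiffAt.isSymmSndFDerivAt (by simp)
      have h2 : iteratedFDeriv ℝ 2 f x (Function.update (fun _ => h) 0 y) =
          iteratedFDeriv ℝ 2 f x (Function.update (fun _ => h) 1 y) := by
        rw [iteratedFDeriv_two_apply, iteratedFDeriv_two_apply]
        simpa using hs y h
      intro i j
      fin_cases i <;> fin_cases j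
      · rfl
      · exact h2
      · exact h2.symm
      · rfl
    · have key : ∀ i : Fin (n + 2 + 1),
          iteratedFDeriv ℝ (n + 2 + 1) f x (Function.update (fun _ => h) i y) =
            iteratedFDeriv ℝ (n + 2 + 1) f x (Function.update (fun _ => h) 1 y) := by
        intro i
        refine Fin.cases ?_ (fun i => ?_) i
        · exact right 0 1
        · exact left i 0
      intro i j
      rw [key i, key j]

/-- Derivative of `u ↦ D^{n+1} f(v)[u - v, …, u - v]`. -/
theorem hasFDerivAt_iteratedFDeriv_pow.{u} {E F : Type u} [NormedAddCommGroup E] [NormedSpace ℝ E]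
    [NormedAddCommGroup F] [NormedSpace ℝ F] {n : ℕ} {f : E → F} (hf : ContDiff ℝ (n + 1 : ℕ) f)
    (v x : E) :
    HasFDerivAt (fun u => iteratedFDeriv ℝ (n + 1) f v (fun _ => u - v))
      ((n + 1 : ℝ) • iteratedFDeriv ℝ n (fderiv ℝ f) v (fun _ => x - v)) x := by
  have h1 := (iteratedFDeriv ℝ (n + 1) f v).hasFDerivAt (x := fun _ => x - v)
  have h2 : HasFDerivAt (fun (u : E) (_ : Fin (n + 1)) => u - v)
      (ContinuousLinearMap.pi fun _ => ContinuousLinearMap.id ℝ E) x :=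
    hasFDerivAt_pi.2 fun _ => (hasFDerivAt_id x).sub_const v
  refine (h1.comp x h2).congr_fderiv ?_
  ext y
  -- The product rule gives one term per slot; by symmetry each equals the term with `y` in the last
  -- slot, whence the factor `n + 1`.
  have h3 : ∀ i : Fin (n + 1),
      iteratedFDeriv ℝ (n + 1) f v (Function.update (fun _ => x - v) i y) =
        iteratedFDeriv ℝ n (fderiv ℝ f) v (fun _ => x - v) y := by
    intro i
    rw [iteratedFDeriv_update_const (n + 1) hf v (x - v) y i (Fin.last n),
      iteratedFDeriv_succ_apply_right, Fin.init_update_last, Function.update_self]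
    rfl
  simp [ContinuousMultilinearMap.linearDeriv_apply, h3, ← Nat.cast_smul_eq_nsmul ℝ]

/-- Taylor's inequality for a `C^n` map whose `n`-th derivative is Lipschitz at `v`. -/
theorem norm_sub_taylor_le.{u} {E : Type u} [NormedAddCommGroup E] [NormedSpace ℝ E] (ℓ : ℝ) (n : ℕ) :
    ∀ {F : Type u} [NormedAddCommGroup F] [NormedSpace ℝ F] {f : E → F} (v : E),
    ContDiff ℝ n f →
    (∀ x, ‖iteratedFDeriv ℝ n f x - iteratedFDeriv ℝ n f v‖ ≤ ℓ * ‖x - v‖) → ∀ x,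
    ‖f x - ∑ j ∈ Finset.range (n + 1), (1 / (j ! : ℝ)) • iteratedFDeriv ℝ j f v (fun _ => x - v)‖
      ≤ ℓ * ‖x - v‖ ^ (n + 1) / ((n + 1)! : ℝ) := by
  induction n with
  | zero =>
    intro F _ _ f v _ hl x
    have h := hl x
    have e : iteratedFDeriv ℝ 0 f x - iteratedFDeriv ℝ 0 f v =
        (continuousMultilinearCurryFin0 ℝ E F).symm (f x - f v) := by
      rw [map_sub]; rfl
    rw [e, LinearIsometryEquiv.norm_map] at h
    simpa using h
  | succ n ih =>
    intro F _ _ f v hf hl x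
    have hf' : ContDiff ℝ n (fderiv ℝ f) := hf.fderiv_right le_rfl
    have hl' : ∀ x, ‖iteratedFDeriv ℝ n (fderiv ℝ f) x - iteratedFDeriv ℝ n (fderiv ℝ f) v‖
        ≤ ℓ * ‖x - v‖ := by
      intro x
      have h := hl x
      rw [iteratedFDeriv_succ_eq_comp_right, iteratedFDeriv_succ_eq_comp_right,
        Function.comp_apply, Function.comp_apply, ← dist_eq_norm,
        LinearIsometryEquiv.dist_map, dist_eq_norm] at h
      exact h
    have IH := ih v hf' hl'
    set h := x - v with hh
    -- The remainder along the segment from `v` to `x`. Its derivative is the remainder of `fderiv ℝ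
    -- f`, one order lower, applied to `h`, so the induction hypothesis bounds it and the mean value
    -- inequality integrates the bound. Differentiation is in `t`, so no symmetry is needed.
    let R : ℝ → F := fun t => f (v + t • h) -
      ∑ j ∈ Finset.range (n + 1 + 1), (t ^ j / (j ! : ℝ)) • iteratedFDeriv ℝ j f v (fun _ => h)
    let R' : ℝ → F := fun t => (fderiv ℝ f (v + t • h) - ∑ j ∈ Finset.range (n + 1),
      (1 / (j ! : ℝ)) • iteratedFDeriv ℝ j (fderiv ℝ f) v (fun _ => v + t • h - v)) h
    have hR : ∀ t, HasDerivAt R (R' t) t := by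
      intro t
      have h1 : HasDerivAt (fun t : ℝ => f (v + t • h)) (fderiv ℝ f (v + t • h) h) t := by
        have h2 : HasDerivAt (fun t : ℝ => v + t • h) h t := by
          simpa using ((hasDerivAt_id t).smul_const h).const_add v
        exact ((hf.differentiable (by simp)) (v + t • h)).hasFDerivAt.comp_hasDerivAt t h2
      have h3 : HasDerivAt (fun t : ℝ => ∑ j ∈ Finset.range (n + 1 + 1),
          (t ^ j / (j ! : ℝ)) • iteratedFDeriv ℝ j f v (fun _ => h))
          (∑ j ∈ Finset.range (n + 1),
            (t ^ j / (j ! : ℝ)) • iteratedFDeriv ℝ (j + 1) f v (fun _ => h)) t := by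
        have h4 : ∀ j ∈ Finset.range (n + 1 + 1), HasDerivAt (fun t : ℝ =>
            (t ^ j / (j ! : ℝ)) • iteratedFDeriv ℝ j f v (fun _ => h))
            (((j : ℝ) * t ^ (j - 1) / (j ! : ℝ)) • iteratedFDeriv ℝ j f v (fun _ => h)) t :=
          fun j _ => ((hasDerivAt_pow j t).div_const _).smul_const _
        refine (HasDerivAt.fun_sum h4).congr_deriv ?_
        rw [Finset.sum_range_succ' _ (n + 1)]
        simp only [Nat.cast_zero, zero_mul, zero_div, zero_smul, add_zero, Nat.add_sub_cancel]
        refine Finset.sum_congr rfl fun j _ => ?_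
        congr 1
        rw [Nat.factorial_succ, Nat.cast_mul, mul_div_mul_left]
        exact_mod_cast Nat.succ_ne_zero j
      refine (h1.sub h3).congr_deriv ?_
      simp only [R', add_sub_cancel_left, sub_apply, sum_apply, smul_apply]
      congr 1
      refine Finset.sum_congr rfl fun j _ => ?_
      rw [iteratedFDeriv_succ_apply_right, (iteratedFDeriv ℝ j (fderiv ℝ f) v).map_smul_univ
        (fun _ => t) (fun _ => h)]
      simp only [Finset.prod_const, Finset.card_univ, Fintype.card_fin,
        smul_apply, smul_smul]
      congr 1
      ring
    have hb : ∀ t ∈ Set.Ico (0 : ℝ) 1, ‖R' t‖ ≤ ℓ * ‖h‖ ^ (n + 1 + 1) / ((n + 1)! : ℝ) * t ^ (n + 1) := by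
      intro t ht
      refine (ContinuousLinearMap.le_opNorm _ _).trans ?_
      refine (mul_le_mul_of_nonneg_right (IH (v + t • h)) (norm_nonneg h)).trans_eq ?_
      rw [add_sub_cancel_left, norm_smul, Real.norm_of_nonneg ht.1]
      ring
    have hB : ∀ t : ℝ, HasDerivAt
        (fun t => ℓ * ‖h‖ ^ (n + 1 + 1) / ((n + 1 + 1)! : ℝ) * t ^ (n + 1 + 1))
        (ℓ * ‖h‖ ^ (n + 1 + 1) / ((n + 1)! : ℝ) * t ^ (n + 1)) t := by
      intro t
      refine ((hasDerivAt_pow (n + 1 + 1) t).const_mul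
        (ℓ * ‖h‖ ^ (n + 1 + 1) / ((n + 1 + 1)! : ℝ))).congr_deriv ?_
      rw [Nat.factorial_succ (n + 1)]
      have : ((n + 1)! : ℝ) ≠ 0 := by positivity
      push_cast
      field_simp
    have h0 : ‖R 0‖ ≤ ℓ * ‖h‖ ^ (n + 1 + 1) / ((n + 1 + 1)! : ℝ) * 0 ^ (n + 1 + 1) := by
      have : R 0 = 0 := by
        simp only [R]
        rw [Finset.sum_range_succ']
        simp
      simp [this]
    have := image_norm_le_of_norm_deriv_right_le_deriv_boundary (f := R) (f' := R')
      (a := 0) (b := 1) (fun t _ => (hR t).continuousAt.continuousWithinAt)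
      (fun t _ => (hR t).hasDerivWithinAt) h0 hB hb (Set.right_mem_Icc.2 zero_le_one)
    simpa [R, hh] using this

/-- Differentiating the Taylor polynomial of `Φ` gives that of `fderiv ℝ Φ`, one order lower. The
regularizer is differentiable also at `x = v` because its exponent `p + 1` exceeds 1. -/
theorem tensorModel_hasFDerivAt {d : ℕ} {p : ℕ} (hp : 1 ≤ p) (M : ℝ) {Φ : RVec d → ℝ}
    (hΦ : ContDiff ℝ p Φ) (v x : RVec d) :
    HasFDerivAt (tensorModel p M Φ v)
      (∑ j ∈ Finset.range p, (1 / (j ! : ℝ)) •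
        iteratedFDeriv ℝ j (fderiv ℝ Φ) v (fun _ => x - v) +
        (M / (p ! : ℝ) * ‖x - v‖ ^ (p - 1)) • innerSL ℝ (x - v)) x := by
  have h1 : HasFDerivAt (fun u => ∑ j ∈ Finset.range (p + 1), (1 / (j ! : ℝ)) *
      iteratedFDeriv ℝ j Φ v (fun _ => u - v)) (∑ j ∈ Finset.range p, (1 / (j ! : ℝ)) •
        iteratedFDeriv ℝ j (fderiv ℝ Φ) v (fun _ => x - v)) x := by
    simp_rw [Finset.sum_range_succ']
    simp only [iteratedFDeriv_zero_apply]
    refine (HasFDerivAt.fun_sum fun j hj => ?_).add_const _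
    have hle : ((j + 1 : ℕ) : WithTop ℕ∞) ≤ p := by
      exact_mod_cast Nat.succ_le_of_lt (Finset.mem_range.1 hj)
    have := (hasFDerivAt_iteratedFDeriv_pow (hΦ.of_le hle) v x).const_mul (1 / ((j + 1)! : ℝ))
    refine this.congr_fderiv ?_
    rw [smul_smul]
    congr 1
    rw [Nat.factorial_succ]
    push_cast
    field_simp
  have h2 : HasFDerivAt (fun u : RVec d => M * ‖u - v‖ ^ (p + 1) / ((p + 1)! : ℝ))
      ((M / (p ! : ℝ) * ‖x - v‖ ^ (p - 1)) • innerSL ℝ (x - v)) x := by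
    have h3 := (hasFDerivAt_norm_rpow (x - v) (p := ((p + 1 : ℕ) : ℝ))
      (by exact_mod_cast Nat.lt_succ_of_le hp)).comp x ((hasFDerivAt_id x).sub_const v)
    have h4 := h3.const_mul (M / ((p + 1)! : ℝ))
    have e : (fun u : RVec d => M * ‖u - v‖ ^ (p + 1) / ((p + 1)! : ℝ)) = fun u =>
        M / ((p + 1)! : ℝ) * ((fun x : RVec d => ‖x‖ ^ ((p + 1 : ℕ) : ℝ)) ∘ fun x => id x - v) u := by
      ext u
      simp only [Function.comp_apply, Real.rpow_natCast, id]
      ring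
    rw [e]
    refine h4.congr_fderiv ?_
    · have : ((p + 1 : ℕ) : ℝ) - 2 = ((p - 1 : ℕ) : ℝ) := by
        rw [Nat.cast_sub hp]; push_cast; ring
      rw [this, Real.rpow_natCast, ContinuousLinearMap.comp_id, smul_smul]
      congr 1
      rw [Nat.factorial_succ]
      push_cast
      field_simp
  exact h1.add h2

/-- The gradient of the `p`-th order Taylor polynomial at `v` approximates `∇Φ` up to
`ℓ ‖x - v‖^p / p!`. -/
theorem ConvexLipschitzDeriv.norm_gradient_sub_le {d p : ℕ} (hp : 1 ≤ p) {ℓ : ℝ} {Φ : RVec d → ℝ}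
    (hΦ : ConvexLipschitzDeriv p ℓ Φ) (M : ℝ) (v x : RVec d) :
    ‖gradient Φ x - (gradient (tensorModel p M Φ v) x -
      (M / (p ! : ℝ) * ‖x - v‖ ^ (p - 1)) • (x - v))‖ ≤ ℓ * ‖x - v‖ ^ p / (p ! : ℝ) := by
  obtain ⟨n, rfl⟩ : ∃ n, p = n + 1 := ⟨p - 1, by omega⟩
  have hC : ContDiff ℝ n (fderiv ℝ Φ) := hΦ.contDiff.fderiv_right le_rfl
  have hl : ∀ x, ‖iteratedFDeriv ℝ n (fderiv ℝ Φ) x - iteratedFDeriv ℝ n (fderiv ℝ Φ) v‖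
      ≤ ℓ * ‖x - v‖ := by
    intro x
    have h := hΦ.lipschitz v x
    rw [iteratedFDeriv_succ_eq_comp_right, iteratedFDeriv_succ_eq_comp_right,
      Function.comp_apply, Function.comp_apply, ← dist_eq_norm,
      LinearIsometryEquiv.dist_map, dist_eq_norm] at h
    exact h
  have key := norm_sub_taylor_le ℓ n v hC hl x
  have hT := (tensorModel_hasFDerivAt hp M hΦ.contDiff v x).fderiv
  have hs : InnerProductSpace.toDual ℝ (RVec d) (x - v) = innerSL ℝ (x - v) := rfl
  rw [← (InnerProductSpace.toDual ℝ (RVec d)).norm_map, map_sub, map_sub, map_smulₛₗ, hs,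
    toDual_gradient, toDual_gradient, hT, RCLike.conj_to_real, add_sub_cancel_right]
  exact key

/-- Gradient inequality for differentiable convex functions. -/
theorem ConvexOn.add_inner_gradient_le {d : ℕ} {Φ : RVec d → ℝ} (hc : ConvexOn ℝ Set.univ Φ)
    {x : RVec d} (hd : DifferentiableAt ℝ Φ x) (y : RVec d) :
    Φ x + inner ℝ (y - x) (gradient Φ x) ≤ Φ y := by
  have h1 : ConvexOn ℝ Set.univ (Φ ∘ AffineMap.lineMap (k := ℝ) x y) := by
    simpa using hc.comp_affineMap (AffineMap.lineMap (k := ℝ) x y)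
  have h2 : HasDerivAt (Φ ∘ AffineMap.lineMap (k := ℝ) x y) (fderiv ℝ Φ x (y - x)) 0 := by
    have h3 : HasFDerivAt Φ (fderiv ℝ Φ x) (AffineMap.lineMap (k := ℝ) x y 0) := by
      simpa using hd.hasFDerivAt
    exact h3.comp_hasDerivAt 0 AffineMap.hasDerivAt_lineMap
  have h4 := h1.le_slope_of_hasDerivAt (Set.mem_univ 0) (Set.mem_univ 1) zero_lt_one h2
  rw [slope_def_field] at h4
  simp only [Function.comp_apply, AffineMap.lineMap_apply_one, AffineMap.lineMap_apply_zero,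
    sub_zero, div_one] at h4
  rw [real_inner_comm, inner_gradient_left]
  linarith

/-! ### Tensor steps satisfy the relative error condition -/

/-- The inexact option of the tensor step gives the relative error bound of Framework I. -/
theorem InexactOption.norm_le {d p : ℕ} (hp : 1 ≤ p) {ℓ σhat σl σu : ℝ} (hℓ : 0 < ℓ)
    {Φ : RVec d → ℝ} (hΦ : ConvexLipschitzDeriv p ℓ Φ) {lam : ℝ} (hlam : 0 < lam) {v x : RVec d}
    (h : InexactOption p ℓ σhat σl σu Φ lam v x) :
    ‖lam • gradient Φ x + x - v‖ ≤ (σhat + σu) * ‖x - v‖ := by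
  set r := ‖x - v‖ with hr
  have hf : (0 : ℝ) < p ! := by positivity
  have hpow : r ^ p = r ^ (p - 1) * r := by rw [← pow_succ, Nat.sub_add_cancel hp]
  set g := gradient (tensorModel p ℓ Φ v) x
  set e := gradient Φ x - (g - (ℓ / (p ! : ℝ) * r ^ (p - 1)) • (x - v)) with he
  have h1 : ‖e‖ ≤ ℓ * r ^ p / (p ! : ℝ) := hΦ.norm_gradient_sub_le hp ℓ v x
  -- Model residual, Taylor error and regularizer: the first is at most `σhat * r`, the other two at
  -- most `σu / 2 * r` each.
  have h2 : lam • gradient Φ x + x - v =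
      (lam • g + x - v) + lam • e - (lam * (ℓ / (p ! : ℝ) * r ^ (p - 1))) • (x - v) := by
    rw [he, smul_sub, smul_sub, smul_smul]; abel
  have h3 : ‖lam • e‖ ≤ lam * (ℓ * r ^ p / (p ! : ℝ)) := by
    rw [norm_smul, Real.norm_of_nonneg hlam.le]
    exact mul_le_mul_of_nonneg_left h1 hlam.le
  have h4 : ‖(lam * (ℓ / (p ! : ℝ) * r ^ (p - 1))) • (x - v)‖ = lam * (ℓ * r ^ p / (p ! : ℝ)) := by
    rw [norm_smul, Real.norm_of_nonneg (by positivity), hpow, ← hr]; ring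
  have h5 : lam * (ℓ * r ^ p / (p ! : ℝ)) ≤ σu / 2 * r := by
    have h6 := mul_le_mul_of_nonneg_right h.upper (show 0 ≤ ℓ / (p ! : ℝ) * r by positivity)
    calc lam * (ℓ * r ^ p / (p ! : ℝ)) = lam * r ^ (p - 1) * (ℓ / (p ! : ℝ) * r) := by
          rw [hpow]; ring
      _ ≤ _ := h6
      _ = σu / 2 * r := by field_simp
  have h7 := norm_sub_le ((lam • g + x - v) + lam • e)
    ((lam * (ℓ / (p ! : ℝ) * r ^ (p - 1))) • (x - v))
  have h8 := norm_add_le (lam • g + x - v) (lam • e)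
  have h9 := h.inexact
  rw [h2]
  linarith

/-- The exact option of the tensor step gives the relative error bound of Framework I. -/
theorem ExactOption.norm_le {d p : ℕ} (hp : 1 ≤ p) {ℓ : ℝ} (hℓ : 0 < ℓ)
    {Φ : RVec d → ℝ} (hΦ : ConvexLipschitzDeriv p ℓ Φ) {lam : ℝ} (hlam : 0 < lam) {v x : RVec d}
    (h : ExactOption p ℓ Φ lam v x) :
    ‖lam • gradient Φ x + x - v‖ ≤ 1 / 2 * ‖x - v‖ := by
  set r := ‖x - v‖ with hr
  have hf : (0 : ℝ) < p ! := by positivity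
  have hp0 : (0 : ℝ) < p := by exact_mod_cast hp
  have hpow : r ^ p = r ^ (p - 1) * r := by rw [← pow_succ, Nat.sub_add_cancel hp]
  have hg : gradient (tensorModel p ((p + 1 : ℝ) * ℓ) Φ v) x = 0 := by
    have : fderiv ℝ (tensorModel p ((p + 1 : ℝ) * ℓ) Φ v) x = 0 :=
      (h.exact_min.isLocalMin Filter.univ_mem).fderiv_eq_zero
    rw [gradient, this, map_zero]
  have h1 := hΦ.norm_gradient_sub_le hp ((p + 1 : ℝ) * ℓ) v x
  rw [hg, zero_sub, sub_neg_eq_add, ← hr] at h1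
  set e := gradient Φ x + ((p + 1 : ℝ) * ℓ / (p ! : ℝ) * r ^ (p - 1)) • (x - v) with he
  -- In terms of `s` the two bounds of the option read `1/2 ≤ p s` and `(p+1) s ≤ 1`. The residual
  -- is at most `s r + (1 - (p+1) s) r = (1 - p s) r ≤ r / 2`.
  set s := lam * r ^ (p - 1) * (ℓ / (p ! : ℝ)) with hs
  have hfac : ((p - 1)! : ℝ) = (p ! : ℝ) / p := by
    rw [← Nat.mul_factorial_pred (by omega : p ≠ 0)]; push_cast; field_simp
  have hs1 : 1 / 2 ≤ p * s := by
    have h6 := mul_le_mul_of_nonneg_right h.lower (show 0 ≤ p * (ℓ / (p ! : ℝ)) by positivity)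
    calc (1 / 2 : ℝ) = ((p - 1)! : ℝ) / (2 * ℓ) * (p * (ℓ / (p ! : ℝ))) := by
          rw [hfac]; field_simp
      _ ≤ _ := h6
      _ = p * s := by rw [hs]; ring
  have hs2 : (p + 1) * s ≤ 1 := by
    have h6 := mul_le_mul_of_nonneg_right h.upper (show 0 ≤ (p + 1) * (ℓ / (p ! : ℝ)) by positivity)
    calc (p + 1) * s = lam * r ^ (p - 1) * ((p + 1) * (ℓ / (p ! : ℝ))) := by rw [hs]; ring
      _ ≤ _ := h6
      _ = 1 := by field_simp
  have h2 : lam • gradient Φ x + x - v = lam • e + (1 - (p + 1) * s) • (x - v) := by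
    have : (p + 1) * s = lam * ((p + 1 : ℝ) * ℓ / (p ! : ℝ) * r ^ (p - 1)) := by rw [hs]; ring
    rw [he, smul_add, smul_smul, sub_smul, this, one_smul]; abel
  have h3 : ‖lam • e‖ ≤ s * r := by
    rw [norm_smul, Real.norm_of_nonneg hlam.le]
    refine (mul_le_mul_of_nonneg_left h1 hlam.le).trans_eq ?_
    rw [hs, hpow]; ring
  have h4 : ‖(1 - (p + 1) * s) • (x - v)‖ = (1 - (p + 1) * s) * r := by
    rw [norm_smul, Real.norm_of_nonneg (by linarith), ← hr]
  have h8 := norm_add_le (lam • e) ((1 - (p + 1) * s) • (x - v))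
  have h9 := mul_le_mul_of_nonneg_right hs1 (norm_nonneg (x - v))
  rw [← hr] at h9
  rw [h2]
  linarith

theorem OptimalIStep.frameworkIStep {d p : ℕ} (hp : 1 ≤ p) {ℓ σhat σl σu σ θ : ℝ}
    {Φ : RVec d → ℝ} (hΦ : ConvexLipschitzDeriv p ℓ Φ) {S S' : IterState d} {lam a : ℝ}
    (h : OptimalIStep p ℓ σhat σl σu Φ S lam a S')
    (herr : ‖lam • gradient Φ S'.x + S'.x - S.extrapolate a‖ ≤ σ * ‖S'.x - S.extrapolate a‖)
    (hθ : θ ≤ lam * ‖S'.x - S.extrapolate a‖ ^ (p - 1)) :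
    FrameworkIStep p σ θ Φ S lam a (gradient Φ S'.x) 0 S' where
  not_stopped := h.not_stopped
  lam_pos := h.lam_pos
  eps_nonneg := le_rfl
  a_pos := h.a_pos
  a_sq := h.a_sq
  mem_subdiff y := by
    rw [sub_zero]
    exact hΦ.convex.add_inner_gradient_le
      ((hΦ.contDiff.differentiable (by exact_mod_cast (by omega : p ≠ 0))) _) y
  rel_error := by
    rw [mul_zero, add_zero, ← mul_pow]
    exact pow_le_pow_left₀ (norm_nonneg _) herr 2
  large_step := hθ
  A_update := h.A_update
  v_update := h.v_update

theorem IsOptimalIRun.isFrameworkIRun {d p : ℕ} (hp : 1 ≤ p) {ℓ σhat σl σu σ θ : ℝ}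
    (hσ : 0 < σ ∧ σ < 1) (hθ : 0 < θ)
    {Φ : RVec d → ℝ} (hΦ : ConvexLipschitzDeriv p ℓ Φ) {x₀ v₀ : RVec d} {N : ℕ∞}
    {S : ℕ → IterState d} {lam a : ℕ → ℝ} (h : IsOptimalIRun p ℓ σhat σl σu Φ x₀ v₀ N S lam a)
    (hstep : ∀ k : ℕ, (k : ℕ∞) < N →
      ‖lam (k + 1) • gradient Φ (S (k + 1)).x + (S (k + 1)).x - (S k).extrapolate (a (k + 1))‖ ≤
        σ * ‖(S (k + 1)).x - (S k).extrapolate (a (k + 1))‖ ∧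
      θ ≤ lam (k + 1) * ‖(S (k + 1)).x - (S k).extrapolate (a (k + 1))‖ ^ (p - 1)) :
    IsFrameworkIRun p σ θ Φ x₀ v₀ N S lam a (fun k => gradient Φ (S k).x) (fun _ => 0) where
  sigma_mem := hσ
  theta_pos := hθ
  init := h.init
  step k hk := (h.step k hk).frameworkIStep hp hΦ (hstep k hk).1 (hstep k hk).2

theorem IsOptimalIRun.isFrameworkIRun_max_min {d p : ℕ} (hp : 1 ≤ p) {ℓ σhat σl σu : ℝ}
    (hℓ : 0 < ℓ) (hσ : AdmissibleParams p σhat σl σu)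
    {Φ : RVec d → ℝ} (hΦ : ConvexLipschitzDeriv p ℓ Φ) {x₀ v₀ : RVec d} {N : ℕ∞}
    {S : ℕ → IterState d} {lam a : ℕ → ℝ}
    (h : IsOptimalIRun p ℓ σhat σl σu Φ x₀ v₀ N S lam a) :
    IsFrameworkIRun p (max (σhat + σu) (1 / 2))
      (min (σl * (p ! : ℝ) / (2 * ℓ)) (((p - 1)! : ℝ) / (2 * ℓ))) Φ x₀ v₀ N S lam a
      (fun k => gradient Φ (S k).x) (fun _ => 0) := by
  have hl := hσ.l_pos
  refine h.isFrameworkIRun hp ⟨lt_max_of_lt_right (by norm_num),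
    max_lt hσ.sum_lt_one (by norm_num)⟩ (lt_min (by positivity) (by positivity)) hΦ ?_
  intro k hk
  have hs := h.step k hk
  rcases hs.option with ho | ho
  · exact ⟨(ho.norm_le hp hℓ hΦ hs.lam_pos).trans
      (mul_le_mul_of_nonneg_right (le_max_left _ _) (norm_nonneg _)),
      (min_le_left _ _).trans ho.lower⟩
  · exact ⟨(ho.norm_le hp hℓ hΦ hs.lam_pos).trans
      (mul_le_mul_of_nonneg_right (le_max_right _ _) (norm_nonneg _)),
      (min_le_right _ _).trans ho.lower⟩

/-! ### The Lyapunov function -/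

/-- One step of Framework I decreases the Lyapunov function
`A (Φ(x) - Φ(z)) + ‖v - z‖² / 2`. -/
theorem FrameworkIStep.potential_le {d p : ℕ} {σ θ : ℝ} {Φ : RVec d → ℝ} {S S' : IterState d}
    {lam a : ℝ} {w : RVec d} {ε : ℝ} (h : FrameworkIStep p σ θ Φ S lam a w ε S') (hA : 0 ≤ S.A)
    (z : RVec d) :
    S'.A * (Φ S'.x - Φ z) + ‖S'.v - z‖ ^ 2 / 2 +
      (1 - σ ^ 2) / 2 * (S'.A / lam * ‖S'.x - S.extrapolate a‖ ^ 2) ≤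
    S.A * (Φ S.x - Φ z) + ‖S.v - z‖ ^ 2 / 2 := by
  have ha := h.a_pos
  have hlam := h.lam_pos
  have hA' : 0 < S.A + a := by linarith
  set e := S'.x - S.extrapolate a with he
  have h1 := h.mem_subdiff S.x
  have h2 := h.mem_subdiff z
  have h3 := h.rel_error
  have h4 : ‖S'.v - z‖ ^ 2 = ‖S.v - z‖ ^ 2 - 2 * (a * inner ℝ (S.v - z) w) + a ^ 2 * ‖w‖ ^ 2 := by
    have : S'.v - z = (S.v - z) - a • w := by rw [h.v_update]; abel
    rw [this, norm_sub_sq_real, inner_smul_right, norm_smul, Real.norm_of_nonneg ha.le, mul_pow]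
  have h5 : ‖lam • w + S'.x - S.extrapolate a‖ ^ 2 =
      lam ^ 2 * ‖w‖ ^ 2 + 2 * (lam * inner ℝ e w) + ‖e‖ ^ 2 := by
    have : lam • w + S'.x - S.extrapolate a = lam • w + e := by rw [he]; abel
    rw [this, norm_add_sq_real, inner_smul_left, norm_smul, Real.norm_of_nonneg hlam.le, mul_pow,
      real_inner_comm w e]
    rfl
  have h6 : (S.A + a) * inner ℝ e w =
      S.A * inner ℝ (S'.x - S.x) w + a * inner ℝ (S'.x - S.v) w := by
    have : (S.A + a) • e = S.A • (S'.x - S.x) + a • (S'.x - S.v) := by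
      rw [he, IterState.extrapolate, smul_sub, smul_add, smul_smul, smul_smul,
        mul_div_cancel₀ _ hA'.ne', mul_div_cancel₀ _ hA'.ne', add_smul, smul_sub, smul_sub]
      abel
    rw [← real_inner_smul_left, this, inner_add_left, real_inner_smul_left, real_inner_smul_left]
  rw [h5] at h3
  -- With this weight, `a² = λ (A + a)` turns the `‖w‖²` term into the `a² ‖w‖² / 2` of `h4`. The
  -- linear terms and `ε` then cancel against the subgradient inequalities at `S.x` and `z`,
  -- weighted by `A` and `a`.
  have h7 : (S.A + a) / (2 * lam) * (lam ^ 2 * ‖w‖ ^ 2 + 2 * (lam * inner ℝ e w) + ‖e‖ ^ 2 +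
      2 * lam * ε) ≤ (S.A + a) / (2 * lam) * (σ ^ 2 * ‖e‖ ^ 2) :=
    mul_le_mul_of_nonneg_left h3 (by positivity)
  have h8 : (S.A + a) / (2 * lam) * (lam ^ 2 * ‖w‖ ^ 2 + 2 * (lam * inner ℝ e w) + ‖e‖ ^ 2 +
      2 * lam * ε) = a ^ 2 * ‖w‖ ^ 2 / 2 + (S.A + a) * inner ℝ e w +
      (S.A + a) / (2 * lam) * ‖e‖ ^ 2 + (S.A + a) * ε := by
    rw [h.a_sq]; field_simp
  rw [h8, h6] at h7
  have h9 : (1 - σ ^ 2) / 2 * ((S.A + a) / lam * ‖e‖ ^ 2) =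
      (S.A + a) / (2 * lam) * ‖e‖ ^ 2 - (S.A + a) / (2 * lam) * (σ ^ 2 * ‖e‖ ^ 2) := by
    field_simp
  have h10 := mul_le_mul_of_nonneg_left h1 hA
  have h11 := mul_le_mul_of_nonneg_left h2 ha.le
  rw [h.A_update, h9, h4]
  simp only [inner_sub_left] at h7 h10 h11 ⊢
  linarith

theorem IsFrameworkIRun.A_nonneg {d p : ℕ} {σ θ : ℝ} {Φ : RVec d → ℝ} {x₀ v₀ : RVec d} {N : ℕ∞}
    {S : ℕ → IterState d} {lam a : ℕ → ℝ} {w : ℕ → RVec d} {ε : ℕ → ℝ}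
    (h : IsFrameworkIRun p σ θ Φ x₀ v₀ N S lam a w ε) (k : ℕ) (hk : (k : ℕ∞) ≤ N) :
    0 ≤ (S k).A := by
  induction k with
  | zero => rw [h.init]
  | succ k ih =>
    have hk' : (k : ℕ∞) < N := lt_of_lt_of_le (by exact_mod_cast Nat.lt_succ_self k) hk
    have := ih hk'.le
    have := (h.step k hk').a_pos
    rw [(h.step k hk').A_update]
    positivity

/-- Telescoping; as `A_0 = 0`, the value `Φ(x₀)` does not enter the bound. -/
theorem IsFrameworkIRun.potential_le {d p : ℕ} {σ θ : ℝ} {Φ : RVec d → ℝ} {x₀ v₀ : RVec d}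
    {N : ℕ∞} {S : ℕ → IterState d} {lam a : ℕ → ℝ} {w : ℕ → RVec d} {ε : ℕ → ℝ}
    (h : IsFrameworkIRun p σ θ Φ x₀ v₀ N S lam a w ε) (z : RVec d) (k : ℕ) (hk : (k : ℕ∞) ≤ N) :
    (S k).A * (Φ (S k).x - Φ z) + ‖(S k).v - z‖ ^ 2 / 2 +
      (1 - σ ^ 2) / 2 * ∑ j ∈ Finset.range k, (S (j + 1)).A / lam (j + 1) *
        ‖(S (j + 1)).x - (S j).extrapolate (a (j + 1))‖ ^ 2 ≤ ‖v₀ - z‖ ^ 2 / 2 := by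
  induction k with
  | zero => simp [h.init]
  | succ k ih =>
    have hk' : (k : ℕ∞) < N := lt_of_lt_of_le (by exact_mod_cast Nat.lt_succ_self k) hk
    have h1 := ih hk'.le
    have h2 := (h.step k hk').potential_le (h.A_nonneg k hk'.le) z
    rw [Finset.sum_range_succ, mul_add]
    linarith

/-! ### Growth of the weights -/

/-- If `a² = λ (A + a)` with `a, λ > 0`, then `√A` grows at least by `√λ / 2`. -/
theorem sqrt_add_half_sqrt_le {A a lam : ℝ} (hA : 0 ≤ A) (ha : 0 < a) (hlam : 0 < lam)
    (h : a ^ 2 = lam * (A + a)) : √A + √lam / 2 ≤ √(A + a) := by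
  have h1 : a = √lam * √(A + a) := by
    rw [← Real.sqrt_mul hlam.le, ← h, Real.sqrt_sq ha.le]
  have h2 : √(A + a) ^ 2 = A + a := Real.sq_sqrt (by positivity)
  have h3 : √lam ^ 2 = lam := Real.sq_sqrt hlam.le
  have h4 : 0 < √(A + a) := Real.sqrt_pos.2 (by positivity)
  have h5 : √lam ≤ √(A + a) := by
    refine le_of_mul_le_mul_right ?_ h4
    rw [← h1, ← sq, h2]; linarith
  -- Here `A = (A + a) - √λ √(A + a) ≤ (√(A + a) - √λ / 2)²`.
  have h6 : √A ≤ √(A + a) - √lam / 2 := by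
    rw [Real.sqrt_le_iff]
    have := Real.sqrt_nonneg lam
    constructor <;> nlinarith
  linarith

/-- The numbers produced by `k` steps of Framework I: the weights `A`, the step sizes `lam` and the
displacements `r`, with large steps and a bound `E` for the weighted sum of the displacements. -/
structure LargeSteps (p : ℕ) (θ E : ℝ) (k : ℕ) (A a lam r : ℕ → ℝ) : Prop where
  init : A 0 = 0
  A_succ : ∀ j < k, A (j + 1) = A j + a (j + 1)
  a_pos : ∀ j < k, 0 < a (j + 1)
  lam_pos : ∀ j < k, 0 < lam (j + 1)
  r_nonneg : ∀ j < k, 0 ≤ r (j + 1)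
  a_sq : ∀ j < k, a (j + 1) ^ 2 = lam (j + 1) * (A j + a (j + 1))
  large : ∀ j < k, θ ≤ lam (j + 1) * r (j + 1) ^ (p - 1)
  sum_le : ∑ j ∈ Finset.range k, A (j + 1) / lam (j + 1) * r (j + 1) ^ 2 ≤ E

namespace LargeSteps

variable {p : ℕ} {θ E : ℝ} {k : ℕ} {A a lam r : ℕ → ℝ}

theorem A_nonneg (h : LargeSteps p θ E k A a lam r) (j : ℕ) (hj : j ≤ k) : 0 ≤ A j := by
  induction j with
  | zero => rw [h.init]
  | succ j ih =>
    have := ih (by omega)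
    have := h.a_pos j hj
    rw [h.A_succ j hj]
    positivity

theorem A_succ_pos (h : LargeSteps p θ E k A a lam r) (j : ℕ) (hj : j < k) : 0 < A (j + 1) := by
  rw [h.A_succ j hj]
  exact add_pos_of_nonneg_of_pos (h.A_nonneg j hj.le) (h.a_pos j hj)

theorem mono (h : LargeSteps p θ E k A a lam r) {l : ℕ} (hl : l ≤ k) :
    LargeSteps p θ E l A a lam r where
  init := h.init
  A_succ j hj := h.A_succ j (by omega)
  a_pos j hj := h.a_pos j (by omega)
  lam_pos j hj := h.lam_pos j (by omega)
  r_nonneg j hj := h.r_nonneg j (by omega)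
  a_sq j hj := h.a_sq j (by omega)
  large j hj := h.large j (by omega)
  sum_le := by
    refine le_trans (Finset.sum_le_sum_of_subset_of_nonneg
      (Finset.range_subset_range.2 hl) fun j hj _ => ?_) h.sum_le
    have hj' := Finset.mem_range.1 hj
    have := h.lam_pos j hj'
    have := h.A_succ_pos j hj'
    positivity

theorem sum_sqrt_le (h : LargeSteps p θ E k A a lam r) :
    ∑ j ∈ Finset.range k, √(lam (j + 1)) ≤ 2 * √(A k) := by
  induction k with
  | zero => simp
  | succ k ih =>
    have h1 := ih (h.mono (Nat.le_succ k))
    have h2 := sqrt_add_half_sqrt_le (h.A_nonneg k (Nat.le_succ k)) (h.a_pos k (Nat.lt_succ_self k))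
      (h.lam_pos k (Nat.lt_succ_self k)) (h.a_sq k (Nat.lt_succ_self k))
    rw [Finset.sum_range_succ, h.A_succ k (Nat.lt_succ_self k)]
    linarith

end LargeSteps

/-- With `α = (p-1)/(3p+1)` the right side equals `A^α (λ r^(p-1))^(2/(3p+1))`: this is the exponent
for which the powers of `λ` and `r` recombine into the quantity bounded below by `θ`, while the two
exponents sum to one as Hölder requires. -/
theorem rpow_mul_rpow_le_of_large_step {p : ℕ} (hp : 1 ≤ p) {θ A lam r : ℝ} (hθ : 0 < θ)
    (hA : 0 ≤ A) (hlam : 0 < lam) (hr : 0 ≤ r) (h : θ ≤ lam * r ^ (p - 1)) :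
    θ ^ (2 / (3 * p + 1) : ℝ) * A ^ ((p - 1) / (3 * p + 1) : ℝ) ≤
      (A / lam * r ^ 2) ^ ((p - 1) / (3 * p + 1) : ℝ) *
        (√lam) ^ (1 - (p - 1) / (3 * p + 1) : ℝ) := by
  have hq : (0 : ℝ) < 3 * p + 1 := by positivity
  have h1 : θ ^ (2 / (3 * p + 1) : ℝ) ≤
      lam ^ (2 / (3 * p + 1) : ℝ) * r ^ (2 * ((p - 1) / (3 * p + 1)) : ℝ) := by
    refine (Real.rpow_le_rpow hθ.le h (by positivity)).trans_eq ?_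
    rw [Real.mul_rpow hlam.le (by positivity), ← Real.rpow_natCast_mul hr, Nat.cast_sub hp]
    congr 2
    push_cast
    ring
  refine (mul_le_mul_of_nonneg_right h1 (Real.rpow_nonneg hA _)).trans_eq ?_
  rw [Real.mul_rpow (by positivity) (by positivity), Real.div_rpow hA hlam.le,
    ← Real.rpow_natCast_mul hr, Real.sqrt_eq_rpow, ← Real.rpow_mul hlam.le]
  have h2 : lam ^ (1 / 2 * (1 - (p - 1) / (3 * p + 1)) : ℝ) =
      lam ^ ((p - 1) / (3 * p + 1) : ℝ) * lam ^ (2 / (3 * p + 1) : ℝ) := by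
    rw [← Real.rpow_add hlam]
    congr 1
    field_simp
    ring
  have h3 : lam ^ ((p - 1) / (3 * p + 1) : ℝ) ≠ 0 := (Real.rpow_pos_of_pos hlam _).ne'
  rw [h2]
  push_cast
  field_simp

/-- Hölder's inequality for a product of powers with exponents that sum to one. -/
theorem sum_rpow_mul_rpow_le {ι : Type*} (s : Finset ι) {f g : ι → ℝ} {α X Y : ℝ} (hα : 0 ≤ α)
    (hα' : α ≤ 1) (hf : ∀ i ∈ s, 0 ≤ f i) (hg : ∀ i ∈ s, 0 ≤ g i) (hX : 0 < X) (hY : 0 < Y)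
    (hfX : ∑ i ∈ s, f i ≤ X) (hgY : ∑ i ∈ s, g i ≤ Y) :
    ∑ i ∈ s, f i ^ α * g i ^ (1 - α) ≤ X ^ α * Y ^ (1 - α) := by
  have hXY : 0 < X ^ α * Y ^ (1 - α) := by positivity
  have h1 : ∀ i ∈ s, f i ^ α * g i ^ (1 - α) ≤
      X ^ α * Y ^ (1 - α) * (α * (f i / X) + (1 - α) * (g i / Y)) := by
    intro i hi
    have h2 := Real.geom_mean_le_arith_mean2_weighted hα (sub_nonneg.2 hα')
      (div_nonneg (hf i hi) hX.le) (div_nonneg (hg i hi) hY.le) (add_sub_cancel α 1)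
    rw [Real.div_rpow (hf i hi) hX.le, Real.div_rpow (hg i hi) hY.le, div_mul_div_comm,
      div_le_iff₀ hXY] at h2
    linarith
  refine (Finset.sum_le_sum h1).trans ?_
  rw [← Finset.mul_sum, Finset.sum_add_distrib, ← Finset.mul_sum, ← Finset.mul_sum,
    ← Finset.sum_div, ← Finset.sum_div]
  refine mul_le_of_le_one_right hXY.le ?_
  have h3 := mul_le_mul_of_nonneg_left ((div_le_one hX).2 hfX) hα
  have h4 := mul_le_mul_of_nonneg_left ((div_le_one hY).2 hgY) (sub_nonneg.2 hα')
  linarith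

/-- A sequence whose increments dominate `κ S^{1-τ}` grows at least like `(τ κ k)^{1/τ}`. -/
theorem mul_le_rpow_of_increment {S : ℕ → ℝ} {τ κ : ℝ} (hτ : 0 < τ) (hτ' : τ ≤ 1) (k : ℕ)
    (h0 : 0 ≤ S 0) (hmono : ∀ j < k, S j < S (j + 1))
    (h : ∀ j < k, κ * S (j + 1) ^ (1 - τ) ≤ S (j + 1) - S j) :
    0 ≤ S k ∧ τ * κ * k ≤ S k ^ τ := by
  induction k with
  | zero => exact ⟨h0, by simpa using Real.rpow_nonneg h0 τ⟩
  | succ k ih =>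
    obtain ⟨hk, ih⟩ := ih (fun j hj => hmono j (by omega)) (fun j hj => h j (by omega))
    have hlt := hmono k (Nat.lt_succ_self k)
    have hpos : 0 < S (k + 1) := hk.trans_lt hlt
    refine ⟨hpos.le, ?_⟩
    -- Bernoulli for the exponent `τ ≤ 1`, applied to the ratio `S k / S (k + 1)`: each step raises
    -- `S^τ` by at least `τ κ`.
    have h1 := rpow_one_add_le_one_add_mul_self
      (s := S k / S (k + 1) - 1) (by linarith [div_nonneg hk hpos.le]) hτ.le hτ'
    rw [add_sub_cancel, Real.div_rpow hk hpos.le, div_le_iff₀ (Real.rpow_pos_of_pos hpos τ)] at h1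
    have h2 := h k (Nat.lt_succ_self k)
    rw [Real.rpow_sub hpos, Real.rpow_one] at h2
    have hP := Real.rpow_pos_of_pos hpos τ
    have h3 : κ ≤ (1 - S k / S (k + 1)) * S (k + 1) ^ τ := by
      have := mul_le_mul_of_nonneg_right h2 (show 0 ≤ S (k + 1) ^ τ / S (k + 1) by positivity)
      calc κ = κ * (S (k + 1) / S (k + 1) ^ τ) * (S (k + 1) ^ τ / S (k + 1)) := by field_simp
        _ ≤ _ := this
        _ = _ := by field_simp
    have h4 := mul_le_mul_of_nonneg_left h3 hτ.le
    push_cast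
    linarith

/-- `∑_{j ≤ k} j^m ≥ k^{m+1} / (m+1)`. -/
theorem rpow_succ_le_sum {m : ℝ} (hm : 0 ≤ m) (k : ℕ) :
    (k : ℝ) ^ (m + 1) ≤ (m + 1) * ∑ j ∈ Finset.range k, ((j + 1 : ℕ) : ℝ) ^ m := by
  induction k with
  | zero => simp [Real.zero_rpow (by linarith : m + 1 ≠ 0)]
  | succ k ih =>
    rw [Finset.sum_range_succ, mul_add]
    have hpos : (0 : ℝ) < ((k + 1 : ℕ) : ℝ) := by positivity
    have h1 := one_add_mul_self_le_rpow_one_add (s := (k : ℝ) / ((k + 1 : ℕ) : ℝ) - 1)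
      (by linarith [show (0 : ℝ) ≤ (k : ℝ) / ((k + 1 : ℕ) : ℝ) by positivity])
      (show 1 ≤ m + 1 by linarith)
    rw [add_sub_cancel, Real.div_rpow (by positivity) hpos.le,
      le_div_iff₀ (Real.rpow_pos_of_pos hpos _)] at h1
    have h2 : (k : ℝ) / ((k + 1 : ℕ) : ℝ) - 1 = -1 / ((k + 1 : ℕ) : ℝ) := by
      push_cast; field_simp; ring
    have h3 : ((k + 1 : ℕ) : ℝ) ^ (m + 1) = ((k + 1 : ℕ) : ℝ) ^ m * ((k + 1 : ℕ) : ℝ) := by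
      rw [Real.rpow_add hpos, Real.rpow_one]
    have h4 : (1 + (m + 1) * (-1 / ((k + 1 : ℕ) : ℝ))) * ((k + 1 : ℕ) : ℝ) ^ (m + 1) =
        ((k + 1 : ℕ) : ℝ) ^ (m + 1) - (m + 1) * ((k + 1 : ℕ) : ℝ) ^ m := by
      rw [h3]; field_simp; ring
    rw [h2, h4] at h1
    linarith

/-- Growth of the weights in Framework I: `A_k ≥ c k^{(3p+1)/2}`. -/
theorem LargeSteps.exists_mul_rpow_le {p : ℕ} (hp : 1 ≤ p) {θ E : ℝ} (hθ : 0 < θ) (hE : 0 < E) :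
    ∃ c : ℝ, 0 < c ∧ ∀ (k : ℕ) (A a lam r : ℕ → ℝ), LargeSteps p θ E k A a lam r →
      c * (k : ℝ) ^ ((3 * p + 1) / 2 : ℝ) ≤ A k := by
  have hp1 : (1 : ℝ) ≤ p := by exact_mod_cast hp
  -- `β = (1 - α) / 2` is the power of `A_k` that Hölder leaves on the right, `1 - τ = α / β`, and
  -- `1 / (τ β) = (3p+1)/2` is the final rate.
  set α : ℝ := (p - 1) / (3 * p + 1) with hα
  set β : ℝ := (p + 1) / (3 * p + 1) with hβ
  set τ : ℝ := 2 / (p + 1) with hτ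
  have hα0 : 0 ≤ α := div_nonneg (by linarith) (by positivity)
  have hα1 : α ≤ 1 := by rw [hα, div_le_one (by positivity)]; linarith
  have hβ0 : 0 < β := by positivity
  have hτ0 : 0 < τ := by positivity
  have hτ1 : τ ≤ 1 := by rw [hτ, div_le_one (by positivity)]; linarith
  set T : ℝ := θ ^ (2 / (3 * p + 1) : ℝ) with hT
  have hT0 : 0 < T := Real.rpow_pos_of_pos hθ _
  set K : ℝ := E ^ α * 2 ^ (1 - α) / T with hK
  have hK0 : 0 < K := by positivity
  set κ : ℝ := (K ^ (1 - τ))⁻¹ with hκ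
  have hκ0 : 0 < κ := by positivity
  refine ⟨((τ * κ) ^ τ⁻¹ / K) ^ β⁻¹, by positivity, fun k A a lam r h => ?_⟩
  set S : ℕ → ℝ := fun k => ∑ j ∈ Finset.range k, A (j + 1) ^ α with hS
  have hSle : ∀ l ≤ k, S l ≤ K * A l ^ β := by
    intro l hl
    rcases Nat.eq_zero_or_pos l with rfl | hl0
    · simpa [hS] using mul_nonneg hK0.le (Real.rpow_nonneg h.init.ge β)
    obtain ⟨i, rfl⟩ : ∃ i, l = i + 1 := ⟨l - 1, by omega⟩
    have hl' := h.mono hl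
    have hApos := h.A_succ_pos i hl
    have h1 : T * S (i + 1) ≤ ∑ j ∈ Finset.range (i + 1),
        (A (j + 1) / lam (j + 1) * r (j + 1) ^ 2) ^ α * (√(lam (j + 1))) ^ (1 - α) := by
      rw [hS, Finset.mul_sum]
      refine Finset.sum_le_sum fun j hj => ?_
      have hj' := Finset.mem_range.1 hj
      exact rpow_mul_rpow_le_of_large_step hp hθ (hl'.A_succ_pos j hj').le (hl'.lam_pos j hj')
        (hl'.r_nonneg j hj') (hl'.large j hj')
    have h2 := sum_rpow_mul_rpow_le (Finset.range (i + 1)) hα0 hα1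
      (f := fun j => A (j + 1) / lam (j + 1) * r (j + 1) ^ 2) (g := fun j => √(lam (j + 1)))
      (fun j hj => by
        have hj' := Finset.mem_range.1 hj
        have := hl'.A_succ_pos j hj'
        have := hl'.lam_pos j hj'
        positivity)
      (fun j _ => Real.sqrt_nonneg _) hE (Y := 2 * √(A (i + 1)))
      (mul_pos two_pos (Real.sqrt_pos.2 hApos)) hl'.sum_le hl'.sum_sqrt_le
    have h3 : (2 * √(A (i + 1))) ^ (1 - α) = 2 ^ (1 - α) * A (i + 1) ^ β := by
      rw [Real.mul_rpow two_pos.le (Real.sqrt_nonneg _), Real.sqrt_eq_rpow,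
        ← Real.rpow_mul hApos.le]
      congr 2
      rw [hα, hβ]; field_simp; ring
    rw [h3] at h2
    have h4 := h1.trans h2
    rw [mul_comm, ← le_div_iff₀ hT0] at h4
    refine h4.trans_eq ?_
    rw [hK]; ring
  have hinv : ∀ l ≤ k, 0 ≤ S l → (S l / K) ^ β⁻¹ ≤ A l := by
    intro l hl hSl
    have h1 : S l / K ≤ A l ^ β := by rw [div_le_iff₀' hK0]; exact hSle l hl
    exact (Real.rpow_inv_le_iff_of_pos (by positivity) (h.A_nonneg l hl) hβ0).2 h1
  have hsucc : ∀ j, S (j + 1) - S j = A (j + 1) ^ α := fun j => by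
    simp only [hS, Finset.sum_range_succ, add_sub_cancel_left]
  have hmono : ∀ j < k, S j < S (j + 1) := fun j hj => by
    have := Real.rpow_pos_of_pos (h.A_succ_pos j hj) α
    linarith [hsucc j]
  have hnonneg : ∀ j ≤ k, 0 ≤ S j := fun j hj => Finset.sum_nonneg fun i hi =>
    Real.rpow_nonneg (h.A_succ_pos i ((Finset.mem_range.1 hi).trans_le hj)).le _
  -- Hölder closes on itself: `S ≤ K A^β` bounds the increment `A^α` of `S` below by `(S /
  -- K)^(α/β)`.
  have hinc : ∀ j < k, κ * S (j + 1) ^ (1 - τ) ≤ S (j + 1) - S j := by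
    intro j hj
    have h1 := hinv (j + 1) hj (hnonneg _ hj)
    have h0 : 0 ≤ S (j + 1) / K := div_nonneg (hnonneg _ hj) hK0.le
    have h2 := Real.rpow_le_rpow (Real.rpow_nonneg h0 _) h1 hα0
    rw [← Real.rpow_mul h0] at h2
    have h3 : β⁻¹ * α = 1 - τ := by rw [hα, hβ, hτ]; field_simp; ring
    rw [h3, Real.div_rpow (hnonneg _ hj) hK0.le] at h2
    rw [hsucc, hκ, inv_mul_eq_div]
    exact h2
  obtain ⟨hSk, hgrow⟩ := mul_le_rpow_of_increment hτ0 hτ1 k (by simp [hS]) hmono hinc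
  have hk0 : (0 : ℝ) ≤ k := Nat.cast_nonneg k
  have h1 : (τ * κ * k) ^ τ⁻¹ ≤ S k :=
    (Real.rpow_inv_le_iff_of_pos (by positivity) hSk hτ0).2 hgrow
  refine le_trans (Eq.le ?_) ((Real.rpow_le_rpow (by positivity)
    (div_le_div_of_nonneg_right h1 hK0.le) (by positivity)).trans (hinv k le_rfl hSk))
  have h2 : ((3 * p + 1) / 2 : ℝ) = τ⁻¹ * β⁻¹ := by rw [hτ, hβ]; field_simp
  rw [h2, Real.mul_rpow (x := τ * κ) (by positivity) hk0, mul_div_right_comm,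
    Real.mul_rpow (by positivity) (Real.rpow_nonneg hk0 τ⁻¹), ← Real.rpow_mul hk0]

/-! ### Decay of the gradients -/

/-- Multiplying `(λ g)^(p+1) ≤ (2 r)^(p+1)` by `θ ≤ λ r^(p-1)` leaves `r` and `λ` only through `(r²
/ λ)^p`; then take the `p`-th root. -/
theorem rpow_le_of_large_step {p : ℕ} (hp : 1 ≤ p) {θ lam r g : ℝ} (hθ : 0 < θ)
    (hlam : 0 < lam) (hr : 0 ≤ r) (hg : 0 ≤ g) (h : θ ≤ lam * r ^ (p - 1)) (hgr : lam * g ≤ 2 * r) :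
    (g ^ 2) ^ ((p + 1) / (2 * p) : ℝ) ≤ (2 ^ (p + 1) / θ) ^ ((p : ℝ)⁻¹) * (r ^ 2 / lam) := by
  have hp0 : (0 : ℝ) < p := by exact_mod_cast hp
  have h1 : g ^ (p + 1) ≤ 2 ^ (p + 1) / θ * (r ^ 2 / lam) ^ p := by
    have h2 := pow_le_pow_left₀ (by positivity) hgr (p + 1)
    have h3 := mul_le_mul h2 h hθ.le (by positivity)
    obtain ⟨n, rfl⟩ : ∃ n, p = n + 1 := ⟨p - 1, by omega⟩
    rw [Nat.add_sub_cancel] at h3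
    rw [div_pow, div_mul_div_comm, le_div_iff₀ (by positivity)]
    refine le_of_mul_le_mul_right ?_ hlam
    calc g ^ (n + 1 + 1) * (θ * lam ^ (n + 1)) * lam
        = (lam * g) ^ (n + 1 + 1) * θ := by ring
      _ ≤ (2 * r) ^ (n + 1 + 1) * (lam * r ^ n) := h3
      _ = 2 ^ (n + 1 + 1) * (r ^ 2) ^ (n + 1) * lam := by ring
  have h4 := Real.rpow_le_rpow (by positivity) h1 (show 0 ≤ (p : ℝ)⁻¹ by positivity)
  rw [Real.mul_rpow (by positivity) (by positivity),
    Real.pow_rpow_inv_natCast (by positivity) (by omega)] at h4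
  refine Eq.trans_le ?_ h4
  rw [← Real.rpow_natCast_mul hg, ← Real.rpow_natCast_mul hg]
  congr 1
  push_cast
  field_simp

/-- The smallest squared gradient norm in Framework I decays like `k^{-3p}`. -/
theorem LargeSteps.exists_le_mul_rpow {p : ℕ} (hp : 1 ≤ p) {θ E : ℝ} (hθ : 0 < θ) (hE : 0 < E) :
    ∃ C : ℝ, 0 < C ∧ ∀ (k : ℕ) (A a lam r g : ℕ → ℝ) (G : ℝ), 1 ≤ k →
      LargeSteps p θ E k A a lam r → (∀ j < k, 0 ≤ g (j + 1)) →
      (∀ j < k, lam (j + 1) * g (j + 1) ≤ 2 * r (j + 1)) →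
      0 ≤ G → (∀ j < k, G ≤ g (j + 1) ^ 2) → G ≤ C * (k : ℝ) ^ (-(3 * (p : ℝ))) := by
  obtain ⟨c, hc, hcA⟩ := LargeSteps.exists_mul_rpow_le hp hθ hE
  have hp0 : (0 : ℝ) < p := by exact_mod_cast hp
  set m : ℝ := (3 * p + 1) / 2 with hm
  set γ : ℝ := (p + 1) / (2 * p) with hγ
  have hm0 : 0 < m := by positivity
  have hγ0 : 0 < γ := by positivity
  set K : ℝ := (2 ^ (p + 1) / θ) ^ ((p : ℝ)⁻¹) with hK
  have hK0 : 0 < K := by positivity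
  refine ⟨(K * E * (m + 1) / c) ^ γ⁻¹, by positivity, fun k A a lam r g G hk h hg hgr hG hGg => ?_⟩
  have hk0 : (0 : ℝ) < k := by exact_mod_cast hk
  -- The `A`-weighted sum of the bounds on `g^(2γ)` is the sum controlled by `E`. Since `∑ A_j`
  -- grows like `k^(m+1)`, `G` decays with exponent `(m + 1) / γ = 3p`.
  have h1 : (∑ j ∈ Finset.range k, A (j + 1)) * G ^ γ ≤ K * E := by
    refine le_trans ?_ (mul_le_mul_of_nonneg_left h.sum_le hK0.le)
    rw [Finset.sum_mul, Finset.mul_sum]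
    refine Finset.sum_le_sum fun j hj => ?_
    have hj' := Finset.mem_range.1 hj
    have h2 := rpow_le_of_large_step hp hθ (h.lam_pos j hj') (h.r_nonneg j hj') (hg j hj')
      (h.large j hj') (hgr j hj')
    have h3 := (Real.rpow_le_rpow hG (hGg j hj') hγ0.le).trans h2
    refine (mul_le_mul_of_nonneg_left h3 (h.A_succ_pos j hj').le).trans_eq ?_
    ring
  have h2 : c * (k : ℝ) ^ (m + 1) / (m + 1) ≤ ∑ j ∈ Finset.range k, A (j + 1) := by
    have h3 : c * ∑ j ∈ Finset.range k, ((j + 1 : ℕ) : ℝ) ^ m ≤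
        ∑ j ∈ Finset.range k, A (j + 1) := by
      rw [Finset.mul_sum]
      exact Finset.sum_le_sum fun j hj => hcA _ _ _ _ _ (h.mono (Finset.mem_range.1 hj))
    refine le_trans ?_ h3
    rw [div_le_iff₀ (by positivity), mul_assoc]
    refine mul_le_mul_of_nonneg_left ?_ hc.le
    rw [mul_comm]
    exact rpow_succ_le_sum hm0.le k
  have h4 : G ^ γ ≤ K * E * (m + 1) / c * (k : ℝ) ^ (-(m + 1)) := by
    have h5 := (mul_le_mul_of_nonneg_right h2 (Real.rpow_nonneg hG γ)).trans h1
    have hkm : 0 < (k : ℝ) ^ (m + 1) := Real.rpow_pos_of_pos hk0 _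
    rw [Real.rpow_neg hk0.le, ← div_eq_mul_inv, le_div_iff₀ hkm, le_div_iff₀ hc]
    rw [div_mul_eq_mul_div, div_le_iff₀ (by positivity)] at h5
    linarith
  have h6 := Real.rpow_le_rpow (Real.rpow_nonneg hG γ) h4 (inv_nonneg.2 hγ0.le)
  rw [Real.rpow_rpow_inv hG hγ0.ne', Real.mul_rpow (by positivity) (by positivity),
    ← Real.rpow_mul hk0.le] at h6
  have h7 : -(m + 1) * γ⁻¹ = -(3 * (p : ℝ)) := by
    rw [hm, hγ]; field_simp; ring
  rwa [h7] at h6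

/-! ### From sequences back to the algorithm -/

/-- Minimality of `z` makes the first two terms of the potential nonnegative, so they can be
dropped. Displacements are read only at positive indices, so the truncated `j - 1` at `j = 0` is
harmless. -/
theorem IsFrameworkIRun.largeSteps {d p : ℕ} {σ θ : ℝ} {Φ : RVec d → ℝ} {x₀ v₀ : RVec d} {N : ℕ∞}
    {S : ℕ → IterState d} {lam a : ℕ → ℝ} {w : ℕ → RVec d} {ε : ℕ → ℝ}
    (h : IsFrameworkIRun p σ θ Φ x₀ v₀ N S lam a w ε) {z : RVec d} (hz : ∀ y, Φ z ≤ Φ y) {k : ℕ}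
    (hk : (k : ℕ∞) ≤ N) {E : ℝ} (hE : ‖v₀ - z‖ ^ 2 / (1 - σ ^ 2) ≤ E) :
    LargeSteps p θ E k (fun j => (S j).A) a lam
      (fun j => ‖(S j).x - (S (j - 1)).extrapolate (a j)‖) := by
  have hlt : ∀ j < k, (j : ℕ∞) < N := fun j hj => lt_of_lt_of_le (by exact_mod_cast hj) hk
  have hσ : 0 < 1 - σ ^ 2 := by nlinarith [h.sigma_mem.1, h.sigma_mem.2]
  refine ⟨by rw [h.init], fun j hj => (h.step j (hlt j hj)).A_update,
    fun j hj => (h.step j (hlt j hj)).a_pos, fun j hj => (h.step j (hlt j hj)).lam_pos,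
    fun j _ => norm_nonneg _, fun j hj => (h.step j (hlt j hj)).a_sq,
    fun j hj => (h.step j (hlt j hj)).large_step, le_trans ?_ hE⟩
  have h1 := h.potential_le z k hk
  have h2 := mul_nonneg (h.A_nonneg k hk) (sub_nonneg.2 (hz (S k).x))
  have h3 : 0 ≤ ‖(S k).v - z‖ ^ 2 := by positivity
  rw [le_div_iff₀ hσ]
  simp only [Nat.add_sub_cancel]
  linarith

/-- As `σ < 1`, `λ w + e` is no longer than the displacement `e`; subtract `e`. -/
theorem FrameworkIStep.lam_mul_norm_le {d p : ℕ} {σ θ : ℝ} {Φ : RVec d → ℝ} {S S' : IterState d}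
    {lam a : ℝ} {w : RVec d} {ε : ℝ} (h : FrameworkIStep p σ θ Φ S lam a w ε S') (hσ : 0 < σ)
    (hσ' : σ < 1) : lam * ‖w‖ ≤ 2 * ‖S'.x - S.extrapolate a‖ := by
  have h1 : ‖lam • w + S'.x - S.extrapolate a‖ ≤ ‖S'.x - S.extrapolate a‖ := by
    refine le_of_sq_le_sq ?_ (norm_nonneg _)
    have := h.rel_error
    have := mul_nonneg h.lam_pos.le h.eps_nonneg
    have := mul_le_of_le_one_left (sq_nonneg ‖S'.x - S.extrapolate a‖)
      (pow_le_one₀ hσ.le hσ'.le (n := 2))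
    linarith
  have h2 := norm_sub_le (lam • w + S'.x - S.extrapolate a) (S'.x - S.extrapolate a)
  have h3 : lam • w + S'.x - S.extrapolate a - (S'.x - S.extrapolate a) = lam • w := by abel
  rw [h3, norm_smul, Real.norm_of_nonneg h.lam_pos.le] at h2
  linarith

/-- Convergence rates of Framework I. -/
theorem IsFrameworkIRun.exists_rates {p : ℕ} (hp : 1 ≤ p) {σ θ : ℝ} (hσ : 0 < σ) (hσ' : σ < 1)
    (hθ : 0 < θ) (R : ℝ) :
    ∃ C : ℝ, 0 < C ∧ ∀ (d : ℕ) (Φ : RVec d → ℝ) (z : RVec d), (∀ y, Φ z ≤ Φ y) →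
      ∀ (x₀ v₀ : RVec d), ‖v₀ - z‖ ≤ R → ∀ (N : ℕ∞) (S : ℕ → IterState d) (lam a : ℕ → ℝ)
        (w : ℕ → RVec d) (ε : ℕ → ℝ), IsFrameworkIRun p σ θ Φ x₀ v₀ N S lam a w ε →
      ∀ k : ℕ, 1 ≤ k → (k : ℕ∞) ≤ N →
        Φ (S k).x - Φ z ≤ C * (k : ℝ) ^ (-((3 * (p : ℝ) + 1) / 2)) ∧
        (⨅ i : Set.Icc 1 k, ‖w i‖ ^ 2) ≤ C * (k : ℝ) ^ (-(3 * (p : ℝ))) := by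
  have hσ2 : 0 < 1 - σ ^ 2 := by nlinarith
  -- The summand 1 keeps `E` positive when `R = 0`, as the normalization in Hölder's inequality
  -- requires.
  set E : ℝ := R ^ 2 / (1 - σ ^ 2) + 1
  have hE : 0 < E := by positivity
  obtain ⟨c, hc, hcA⟩ := LargeSteps.exists_mul_rpow_le hp hθ hE
  obtain ⟨C, hC, hCG⟩ := LargeSteps.exists_le_mul_rpow hp hθ hE
  refine ⟨max (R ^ 2 / 2 / c) C, lt_max_of_lt_right hC, ?_⟩
  intro d Φ z hz x₀ v₀ hR N S lam a w ε h k hk hkN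
  have hR2 : ‖v₀ - z‖ ^ 2 ≤ R ^ 2 := pow_le_pow_left₀ (norm_nonneg _) hR 2
  have hL := h.largeSteps hz hkN (E := E)
    ((div_le_div_of_nonneg_right hR2 hσ2.le).trans (by linarith))
  have hk0 : (0 : ℝ) < k := by exact_mod_cast hk
  have hlt : ∀ j < k, (j : ℕ∞) < N := fun j hj => lt_of_lt_of_le (by exact_mod_cast hj) hkN
  constructor
  · refine le_trans ?_ (mul_le_mul_of_nonneg_right (le_max_left _ _) (by positivity))
    have h1 := hcA k _ _ _ _ hL
    have h2 := sub_nonneg.2 (hz (S k).x)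
    have h3 : (S k).A * (Φ (S k).x - Φ z) ≤ R ^ 2 / 2 := by
      have h4 := h.potential_le z k hkN
      have h5 : 0 ≤ ‖(S k).v - z‖ ^ 2 := by positivity
      have h6 : 0 ≤ ∑ j ∈ Finset.range k, (S (j + 1)).A / lam (j + 1) *
          ‖(S (j + 1)).x - (S j).extrapolate (a (j + 1))‖ ^ 2 :=
        Finset.sum_nonneg fun j hj => by
          have hj' := Finset.mem_range.1 hj
          have := (h.step j (hlt j hj')).lam_pos
          have := hL.A_succ_pos j hj'
          positivity
      have h7 := mul_nonneg (show 0 ≤ (1 - σ ^ 2) / 2 by linarith) h6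
      linarith
    have h8 := (mul_le_mul_of_nonneg_right h1 h2).trans h3
    rw [Real.rpow_neg hk0.le, ← div_eq_mul_inv, le_div_iff₀ (by positivity), le_div_iff₀ hc]
    linarith
  · refine le_trans ?_ (mul_le_mul_of_nonneg_right (le_max_right _ _) (by positivity))
    have hbdd : BddBelow (Set.range fun i : Set.Icc 1 k => ‖w i‖ ^ 2) :=
      ⟨0, by rintro _ ⟨i, rfl⟩; positivity⟩
    refine hCG k _ _ _ _ (fun j => ‖w j‖) _ hk hL (fun j _ => norm_nonneg _)
      (fun j hj => (h.step j (hlt j hj)).lam_mul_norm_le hσ hσ')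
      (Real.iInf_nonneg fun i => by positivity)
      (fun j hj => ciInf_le hbdd (⟨j + 1, Nat.le_add_left 1 j, hj⟩ : Set.Icc 1 k))

theorem mainTheorem6 (p : ℕ) (hp : 1 ≤ p) (ℓ : ℝ) (hℓ : 0 < ℓ) (σhat σl σu : ℝ)
    (hσ : AdmissibleParams p σhat σl σu) :
    -- the algorithm is an instance of Framework I, with `w_k = ∇Φ(x_k)` and `ε_k = 0`
    (∀ (d : ℕ) (Φ : RVec d → ℝ), ConvexLipschitzDeriv p ℓ Φ →
      ∀ (x₀ v₀ : RVec d) (N : ℕ∞) (S : ℕ → IterState d) (lam a : ℕ → ℝ),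
        IsOptimalIRun p ℓ σhat σl σu Φ x₀ v₀ N S lam a →
          -- first option in every iteration
          ((∀ k : ℕ, (k : ℕ∞) < N → InexactOption p ℓ σhat σl σu Φ (lam (k + 1))
              ((S k).extrapolate (a (k + 1))) (S (k + 1)).x) →
            IsFrameworkIRun p (σhat + σu) (σl * (p ! : ℝ) / (2 * ℓ)) Φ x₀ v₀ N S lam a
              (fun k => gradient Φ (S k).x) (fun _ => 0)) ∧
          -- second option in every iteration
          ((∀ k : ℕ, (k : ℕ∞) < N → ExactOption p ℓ Φ (lam (k + 1))
              ((S k).extrapolate (a (k + 1))) (S (k + 1)).x) →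
            IsFrameworkIRun p (1 / 2) (((p - 1)! : ℝ) / (2 * ℓ)) Φ x₀ v₀ N S lam a
              (fun k => gradient Φ (S k).x) (fun _ => 0)) ∧
          -- the option may change from one iteration to the next
          IsFrameworkIRun p (max (σhat + σu) (1 / 2))
            (min (σl * (p ! : ℝ) / (2 * ℓ)) (((p - 1)! : ℝ) / (2 * ℓ))) Φ x₀ v₀ N S lam a
            (fun k => gradient Φ (S k).x) (fun _ => 0)) ∧
    -- the rates, with a constant that depends only on the parameters and on a bound for the
    -- distance from `v₀` to the minimizer
    (∀ R : ℝ, ∃ C : ℝ, 0 < C ∧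
      ∀ (d : ℕ) (Φ : RVec d → ℝ), ConvexLipschitzDeriv p ℓ Φ →
        ∀ xstar : RVec d, (∀ y : RVec d, Φ xstar ≤ Φ y) →
          ∀ (x₀ v₀ : RVec d), ‖v₀ - xstar‖ ≤ R →
            ∀ (N : ℕ∞) (S : ℕ → IterState d) (lam a : ℕ → ℝ),
              IsOptimalIRun p ℓ σhat σl σu Φ x₀ v₀ N S lam a →
                ∀ k : ℕ, 1 ≤ k → (k : ℕ∞) ≤ N →
                  Φ (S k).x - Φ xstar ≤ C * (k : ℝ) ^ (-((3 * (p : ℝ) + 1) / 2)) ∧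
                  (⨅ i : Set.Icc 1 k, ‖gradient Φ (S i).x‖ ^ 2)
                    ≤ C * (k : ℝ) ^ (-(3 * (p : ℝ)))) := by
  have hhat := hσ.hat_pos
  have hl := hσ.l_pos
  have hu := hσ.l_lt_u
  refine ⟨fun d Φ hΦ x₀ v₀ N S lam a h => ⟨fun ho => ?_, fun ho => ?_,
    h.isFrameworkIRun_max_min hp hℓ hσ hΦ⟩, fun R => ?_⟩
  · exact h.isFrameworkIRun hp ⟨by linarith, hσ.sum_lt_one⟩ (by positivity) hΦ fun k hk =>
      ⟨(ho k hk).norm_le hp hℓ hΦ (h.step k hk).lam_pos, (ho k hk).lower⟩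
  · exact h.isFrameworkIRun hp ⟨by norm_num, by norm_num⟩ (by positivity) hΦ fun k hk =>
      ⟨(ho k hk).norm_le hp hℓ hΦ (h.step k hk).lam_pos, (ho k hk).lower⟩
  -- The parameters of the mixed case cover every execution, so one constant serves for all choices
  -- of options.
  · obtain ⟨C, hC, hrates⟩ := IsFrameworkIRun.exists_rates hp (σ := max (σhat + σu) (1 / 2))
      (θ := min (σl * (p ! : ℝ) / (2 * ℓ)) (((p - 1)! : ℝ) / (2 * ℓ)))
      (lt_max_of_lt_right (by norm_num)) (max_lt hσ.sum_lt_one (by norm_num))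
      (lt_min (by positivity) (by positivity)) R
    exact ⟨C, hC, fun d Φ hΦ z hz x₀ v₀ hR N S lam a h k hk hkN =>
      hrates d Φ z hz x₀ v₀ hR N S lam a _ _ (h.isFrameworkIRun_max_min hp hℓ hσ hΦ) k hk hkN⟩
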